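/- Consider a stochastic bandit with arms $[k]=\{1,\dots,k\}$, $k\ge 1$, in which every pull of arm $i$ gives an independent $\mathrm{Bernoulli}(\mu_i)$ reward, with $\mu_i\in[0,1]$ and $\mu_1>\mu_i$ for all $i\ne 1$, and put $\Delta_i=\mu_1-\mu_i$. Let $r=(r_1,\dots,r_k)$ with $r_i\in[0,1/k)$ and let $\alpha\ge 0$ be a real number. Write $N_{i,t}$ for the number of pulls of arm $i$ in the first $t$ rounds, and $S_{i,t}$ for the total reward they gave. The algorithm Fair-UCB does the following in each round $t=1,2,\dots$. If $r_j(t-1)-N_{j,t-1}>\alpha$ for some arm $j$, it pulls an arm that maximizes $r_i(t-1)-N_{i,t-1}$ over $i\in[k]$. Otherwise it pulls the arm chosen by UCB1: an arm that has not been pulled yet, if there is one, and else an arm that maximizes $\frac{S_{i,t-1}}{N_{i,t-1}}+\sqrt{\frac{2\ln t}{N_{i,t-1}}}$. Ties (and the order of the initial pulls) are resolved arbitrarily. The $r$-regret after $T$ rounds is $$\mathcal R^{r}(T)=\sum_{i\in[k]}\Delta_i\Big(\mathbb E[N_{i,T}]-\max\big(0,\lfloor r_iT\rfloor-\alpha\big)\Big).$$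 Then for every $T\ge 1$ the $r$-regret of Fair-UCB satisfies $$\mathcal R^{r}_{\text{Fair-UCB}}(T)\le\Big(1+\frac{\pi^2}{3}\Big)\sum_{i\in[k]}\Delta_i+\sum_{i\in S(T),\,i\neq 1}\Delta_i\Big(\frac{8\ln T}{\Delta_i^2}-(r_iT-\alpha)\Big),$$ where $S(T)=\{i\in[k] : r_iT-\alpha<8\ln T/\Delta_i^2\}$. Moreover, if $r_i>0$ for every $i\ne 1$, then there is a $T_0$, depending only on $k$, $\mu$, $r$ and $\alpha$, such that for all $T\ge T_0$ $$\mathcal R^{r}_{\text{Fair-UCB}}(T)\le\Big(1+\frac{\pi^2}{3}\Big)\sum_{i\in[k]}\Delta_i .$$ -/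

import Mathlib

namespace FairMAB

/-- The history of the first `t` rounds of a bandit with `k` arms and Bernoulli rewards: for each
round the arm pulled and the reward collected (`true` is reward `1`, `false` is reward `0`).
The entry with index `s : Fin t` belongs to round `s + 1`. -/
abbrev History (k t : ℕ) : Type := Fin t → Fin k × Bool

/-- A (possibly randomized) bandit algorithm: given the history of the first `t` rounds, it draws
the arm to be pulled in round `t + 1`. Randomization is there to allow any tie-breaking. -/
abbrev Algorithm (k : ℕ) : Type := (t : ℕ) → History k t → PMF (Fin k)

/-- `N_{i,t}`: the number of pulls of arm `i` in the first `t` rounds. -/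
def pulls {k t : ℕ} (h : History k t) (i : Fin k) : ℕ :=
  ∑ s : Fin t, if (h s).1 = i then 1 else 0

/-- `S_{i,t}`: the total reward of arm `i` in the first `t` rounds. -/
def totalReward {k t : ℕ} (h : History k t) (i : Fin k) : ℕ :=
  ∑ s : Fin t, if (h s).1 = i ∧ (h s).2 = true then 1 else 0

/-- The mass function of the Bernoulli distribution with mean `p`. -/
def bernoulliMass (p : ℝ) (x : Bool) : ℝ := if x = true then p else 1 - p

/-- The probability that the algorithm `A` produces the history `h` when arm `i` has
`Bernoulli (μ i)` rewards: given the past, the arm of the next round is drawn by `A`, and given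
the past and that arm `i`, the reward is `Bernoulli (μ i)`. -/
noncomputable def historyProb {k : ℕ} (μ : Fin k → ℝ) (A : Algorithm k) :
    (t : ℕ) → History k t → ℝ
  | 0, _ => 1
  | t + 1, h =>
      historyProb μ A t (Fin.init h) *
        ((A t (Fin.init h) (h (Fin.last t)).1).toReal *
          bernoulliMass (μ (h (Fin.last t)).1) (h (Fin.last t)).2)

/-- `𝔼[N_{i,T}]` under the algorithm `A`. -/
noncomputable def expectedPulls {k : ℕ} (μ : Fin k → ℝ) (A : Algorithm k) (T : ℕ) (i : Fin k) :
    ℝ :=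
  ∑ h : History k T, historyProb μ A T h * (pulls h i : ℝ)

/-- The gap `Δ_i = μ_1 - μ_i`; arm `0 : Fin k` is the arm called `1` on paper. -/
def gap {k : ℕ} [NeZero k] (μ : Fin k → ℝ) (i : Fin k) : ℝ := μ 0 - μ i

/-- The `r`-regret
`∑ i, Δ_i * (𝔼[N_{i,T}] - max (0, ⌊r_i T⌋ - α))` of the algorithm `A` after `T` rounds. -/
noncomputable def rRegret {k : ℕ} [NeZero k] (μ r : Fin k → ℝ) (α : ℝ) (A : Algorithm k)
    (T : ℕ) : ℝ :=
  ∑ i : Fin k, gap μ i * (expectedPulls μ A T i - max 0 ((⌊r i * (T : ℝ)⌋ : ℝ) - α))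

/-- The UCB1 estimate of arm `i` in round `t + 1`, after the history `h` of `t` rounds:
empirical mean plus `√(2 ln (t + 1) / N_{i,t})`. It is used only when `N_{i,t} > 0`. -/
noncomputable def ucbIndex {k t : ℕ} (h : History k t) (i : Fin k) : ℝ :=
  (totalReward h i : ℝ) / (pulls h i : ℝ) +
    Real.sqrt (2 * Real.log ((t : ℝ) + 1) / (pulls h i : ℝ))

/-- `a` is an arm that UCB1 may pull after the history `h`: as long as some arm has not been
pulled yet, an arm that has not been pulled yet; afterwards, an arm with the largest
UCB1 estimate. -/
def IsUCB1Choice {k t : ℕ} (h : History k t) (a : Fin k) : Prop :=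
  if ∃ j, pulls h j = 0 then pulls h a = 0 else ∀ j, ucbIndex h j ≤ ucbIndex h a

/-- `a` is an arm that Fair-Learn, with fairness vector `r`, unfairness tolerance `α` and learning
algorithm `Learn` (the relation between histories and the arms that it may pull next), may pull in
round `t + 1` after the history `h` of `t` rounds: if `r_j t - N_{j,t} > α` for some arm `j`, an
arm with the largest `r_j t - N_{j,t}`; otherwise an arm selected by `Learn`. -/
def IsFairLearnChoice {k : ℕ} (r : Fin k → ℝ) (α : ℝ)
    (Learn : {t : ℕ} → History k t → Fin k → Prop) {t : ℕ} (h : History k t) (a : Fin k) : Prop :=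
  if ∃ j, α < r j * (t : ℝ) - (pulls h j : ℝ) then
    ∀ j, r j * (t : ℝ) - (pulls h j : ℝ) ≤ r a * (t : ℝ) - (pulls h a : ℝ)
  else Learn h a

/-- `A` is the algorithm Fair-UCB, i.e. Fair-Learn with UCB1 as the learner, with an arbitrary
rule for breaking ties: after every history, it only pulls arms that Fair-UCB may pull. -/
def IsFairUCB {k : ℕ} (r : Fin k → ℝ) (α : ℝ) (A : Algorithm k) : Prop :=
  ∀ (t : ℕ) (h : History k t), ∀ a ∈ (A t h).support,
    IsFairLearnChoice r α (fun h a => IsUCB1Choice h a) h a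

open scoped Classical in
/-- The sub-optimal arms of `S(T) = {i | r_i T - α < 8 ln T / Δ_i ^ 2}`. -/
noncomputable def subOptS {k : ℕ} [NeZero k] (μ r : Fin k → ℝ) (α : ℝ) (T : ℕ) :
    Finset (Fin k) :=
  Finset.univ.filter fun i =>
    i ≠ 0 ∧ r i * (T : ℝ) - α < 8 * Real.log (T : ℝ) / gap μ i ^ 2

end FairMAB

namespace FairMAB

open Finset

/-! Fix a suboptimal arm `i` and an integer `M ≥ 1` above both `r i * T - α` and `8 ln T / Δ_i²`.
Once `i` has `M` pulls, it cannot be a fairness pull, since its deficit is at most `α`, and a UCB1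
pull forces arm `0` or arm `i` to deviate from its mean by its confidence width. An exponential
supermartingale bounds each deviation probability by `t / (t + 1) ^ 4`, so `i` is pulled at most `M
+ 2` times in expectation (`historyExp_max_pulls_le`, `expectedPulls_le`). Rounding `M` and the
floor in the regret cost one each, and `4 ≤ 1 + π² / 3`. -/

/-- The expectation of `F` over the history of the first `t` rounds. -/
noncomputable def historyExp {k : ℕ} (μ : Fin k → ℝ) (A : Algorithm k) (t : ℕ)
    (F : History k t → ℝ) : ℝ :=
  ∑ h : History k t, historyProb μ A t h * F h

/-- The conditional expectation of `F` given the history `h` of all rounds but the last. -/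
noncomputable def stepExp {k t : ℕ} (μ : Fin k → ℝ) (A : Algorithm k)
    (F : History k (t + 1) → ℝ) (h : History k t) : ℝ :=
  ∑ a, (A t h a).toReal * ∑ x, bernoulliMass (μ a) x * F (Fin.snoc (α := fun _ => Fin k × Bool) h (a, x))

lemma bernoulliMass_nonneg {p : ℝ} (hp : p ∈ Set.Icc (0 : ℝ) 1) (x : Bool) :
    0 ≤ bernoulliMass p x := by
  unfold bernoulliMass
  split_ifs <;> linarith [hp.1, hp.2]

lemma sum_bernoulliMass (p : ℝ) : ∑ x, bernoulliMass p x = 1 := by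
  simp [bernoulliMass]

lemma sum_toReal_pmf {ι : Type*} [Fintype ι] (p : PMF ι) : ∑ a, (p a).toReal = 1 := by
  rw [← ENNReal.toReal_sum fun a _ => p.apply_ne_top a, ← tsum_fintype (L := .unconditional _),
    p.tsum_coe, ENNReal.toReal_one]

lemma historyProb_nonneg {k : ℕ} {μ : Fin k → ℝ} (hμ : ∀ i, μ i ∈ Set.Icc (0 : ℝ) 1)
    (A : Algorithm k) : ∀ (t : ℕ) (h : History k t), 0 ≤ historyProb μ A t h
  | 0, _ => zero_le_one
  | t + 1, _ => mul_nonneg (historyProb_nonneg hμ A t _)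
      (mul_nonneg ENNReal.toReal_nonneg (bernoulliMass_nonneg (hμ _) _))

lemma historyExp_mono {k : ℕ} {μ : Fin k → ℝ} (hμ : ∀ i, μ i ∈ Set.Icc (0 : ℝ) 1)
    (A : Algorithm k) {t : ℕ} {F G : History k t → ℝ} (hFG : ∀ h, F h ≤ G h) :
    historyExp μ A t F ≤ historyExp μ A t G :=
  sum_le_sum fun h _ => mul_le_mul_of_nonneg_left (hFG h) (historyProb_nonneg hμ A t h)

lemma historyExp_succ {k : ℕ} (μ : Fin k → ℝ) (A : Algorithm k) (t : ℕ)
    (F : History k (t + 1) → ℝ) :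
    historyExp μ A (t + 1) F = historyExp μ A t (stepExp μ A F) := by
  unfold historyExp stepExp
  rw [← (Fin.snocEquiv fun _ : Fin (t + 1) => Fin k × Bool).sum_comp, Fintype.sum_prod_type_right]
  refine sum_congr rfl fun h _ => ?_
  rw [Fintype.sum_prod_type, mul_sum]
  refine sum_congr rfl fun a _ => ?_
  simp only [mul_sum]
  refine sum_congr rfl fun x _ => ?_
  have hsnoc : (Fin.snocEquiv fun _ : Fin (t + 1) => Fin k × Bool) ((a, x), h) =
    Fin.snoc (α := fun _ => Fin k × Bool) h (a, x) := rfl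
  rw [hsnoc]
  simp only [historyProb, Fin.init_snoc, Fin.snoc_last]
  ring

lemma historyExp_add {k : ℕ} (μ : Fin k → ℝ) (A : Algorithm k) (t : ℕ)
    (F G : History k t → ℝ) :
    historyExp μ A t (fun h => F h + G h) = historyExp μ A t F + historyExp μ A t G := by
  simp only [historyExp, mul_add, sum_add_distrib]

lemma historyExp_sum_mul {k : ℕ} {ι : Type*} (μ : Fin k → ℝ) (A : Algorithm k) (t : ℕ)
    (s : Finset ι) (F : ι → History k t → ℝ) (c : ℝ) :
    historyExp μ A t (fun h => ∑ n ∈ s, F n h * c) =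
      ∑ n ∈ s, historyExp μ A t (F n) * c := by
  simp only [historyExp, mul_sum, sum_mul]
  rw [sum_comm]
  simp only [mul_assoc]

/-- Only arms in the support need control, which makes the bounds uniform in the tie-breaking. -/
lemma stepExp_le {k t : ℕ} {μ : Fin k → ℝ} (A : Algorithm k) {F : History k (t + 1) → ℝ}
    {h : History k t} {c : ℝ}
    (hc : ∀ a ∈ (A t h).support, ∑ x, bernoulliMass (μ a) x *
      F (Fin.snoc (α := fun _ => Fin k × Bool) h (a, x)) ≤ c) :
    stepExp μ A F h ≤ c := by
  calc stepExp μ A F h ≤ ∑ a, (A t h a).toReal * c := by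
        refine sum_le_sum fun a _ => ?_
        by_cases ha : a ∈ (A t h).support
        · exact mul_le_mul_of_nonneg_left (hc a ha) ENNReal.toReal_nonneg
        · rw [PMF.mem_support_iff, not_not] at ha
          simp [ha]
    _ = c := by rw [← sum_mul, sum_toReal_pmf, one_mul]

lemma pulls_snoc {k t : ℕ} (h : History k t) (a : Fin k) (x : Bool) (i : Fin k) :
    pulls (t := t + 1) (Fin.snoc (α := fun _ => Fin k × Bool) h (a, x)) i =
      pulls h i + if a = i then 1 else 0 := by
  simp only [pulls, Fin.sum_univ_castSucc, Fin.snoc_castSucc, Fin.snoc_last]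

lemma totalReward_snoc {k t : ℕ} (h : History k t) (a : Fin k) (x : Bool) (i : Fin k) :
    totalReward (t := t + 1) (Fin.snoc (α := fun _ => Fin k × Bool) h (a, x)) i =
      totalReward h i + if a = i ∧ x = true then 1 else 0 := by
  simp only [totalReward, Fin.sum_univ_castSucc, Fin.snoc_castSucc, Fin.snoc_last]

lemma pulls_le {k t : ℕ} (h : History k t) (i : Fin k) : pulls h i ≤ t := by
  unfold pulls
  calc _ ≤ ∑ _s : Fin t, 1 := sum_le_sum fun s _ => by split_ifs <;> simp
    _ = t := by simp

/-! ### Concentration of the rewards of one arm -/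

/-- Hoeffding's lemma for a Bernoulli variable. -/
lemma bernoulli_mgf_le {p : ℝ} (hp : p ∈ Set.Icc (0 : ℝ) 1) (l : ℝ) :
    p * Real.exp (l * (1 - p)) + (1 - p) * Real.exp (l * (0 - p)) ≤ Real.exp (l ^ 2 / 8) := by
  have h := (ProbabilityTheory.hasSubgaussianMGF_of_mem_Icc
    (μ := ProbabilityTheory.bernoulliMeasure true false ⟨p, hp⟩)
    (X := fun b : Bool => if b then (1 : ℝ) else 0) (a := 0) (b := 1)
    (measurable_of_countable _).aemeasurable
    (Filter.Eventually.of_forall fun b => by cases b <;> simp)).mgf_le l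
  simp only [ProbabilityTheory.mgf, ProbabilityTheory.integral_bernoulliMeasure] at h
  refine (le_of_eq ?_).trans (h.trans (le_of_eq ?_))
  · simp
  · simp
    ring

/-- The exponential process of the centred total reward of arm `i`. -/
noncomputable def expProcess {k t : ℕ} (m l : ℝ) (i : Fin k) (h : History k t) : ℝ :=
  Real.exp (l * (totalReward h i - m * pulls h i) - l ^ 2 / 8 * pulls h i)

/-- Supermartingale property: a pull of `i` multiplies the process by a factor of mean at most one
(Hoeffding), and any other pull leaves it unchanged. -/
lemma historyExp_expProcess_le {k : ℕ} {μ : Fin k → ℝ} (hμ : ∀ i, μ i ∈ Set.Icc (0 : ℝ) 1)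
    (A : Algorithm k) (l : ℝ) (i : Fin k) (t : ℕ) :
    historyExp μ A t (expProcess (μ i) l i) ≤ 1 := by
  induction t with
  | zero => simp [historyExp, historyProb, expProcess, pulls, totalReward]
  | succ t ih =>
    rw [historyExp_succ]
    refine (historyExp_mono hμ A fun h => stepExp_le A fun a _ => ?_).trans ih
    by_cases ha : a = i
    · subst ha
      have key := mul_le_mul_of_nonneg_left (bernoulli_mgf_le (hμ a) l)
        (mul_nonneg (Real.exp_nonneg (-(l ^ 2 / 8)))
          (Real.exp_nonneg (l * (totalReward h a - μ a * pulls h a) - l ^ 2 / 8 * pulls h a)))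
      refine (le_of_eq ?_).trans (key.trans (le_of_eq ?_))
      · simp only [Fintype.sum_bool, expProcess, pulls_snoc, totalReward_snoc, bernoulliMass,
          mul_add, mul_left_comm _ (μ a), mul_left_comm _ (1 - μ a), ← Real.exp_add]
        push_cast
        simp
        ring_nf
      · rw [expProcess, ← Real.exp_add, ← Real.exp_add]
        ring_nf
    · simp only [expProcess, pulls_snoc, totalReward_snoc, ha, false_and, if_false, add_zero,
        ← sum_mul, sum_bernoulliMass, one_mul, le_refl]

/-- After the history `h`, the total reward of arm `i`, pulled at least once, deviates from its
mean on the side of the sign `e` by the UCB1 confidence width. -/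
def Deviates {k t : ℕ} (m e : ℝ) (i : Fin k) (h : History k t) : Prop :=
  1 ≤ pulls h i ∧
    Real.sqrt (2 * Real.log ((t : ℝ) + 1) * pulls h i) ≤ e * (totalReward h i - m * pulls h i)

/-- With `g = ln (t + 1)`, this is the optimal Chernoff parameter for deviation `√(2gN)`: the
exponent is at least `8g - 4g = 4g`. -/
lemma one_le_expProcess_of_deviates {k t : ℕ} {m e : ℝ} (he : e ^ 2 = 1) {i : Fin k}
    {h : History k t} (hd : Deviates m e i h) :
    1 ≤ expProcess m (e * (4 * Real.sqrt (2 * Real.log ((t : ℝ) + 1) / pulls h i))) i h *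
      (((t : ℝ) + 1) ^ 4)⁻¹ := by
  obtain ⟨h1, h2⟩ := hd
  have hN : (0 : ℝ) < pulls h i := by exact_mod_cast h1
  have ht : (0 : ℝ) < (t : ℝ) + 1 := by positivity
  set N : ℝ := (pulls h i : ℝ)
  set g := Real.log ((t : ℝ) + 1) with hg
  have hg0 : 0 ≤ g := Real.log_nonneg (by linarith [t.cast_nonneg (α := ℝ)])
  have hs : Real.sqrt (2 * g / N) * Real.sqrt (2 * g * N) = 2 * g := by
    rw [← Real.sqrt_mul (by positivity),
      show 2 * g / N * (2 * g * N) = (2 * g) ^ 2 by field_simp, Real.sqrt_sq (by positivity)]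
  have hsq : Real.sqrt (2 * g / N) ^ 2 * N = 2 * g := by
    rw [Real.sq_sqrt (by positivity)]; field_simp
  have hexp : ((t : ℝ) + 1) ^ 4 = Real.exp (4 * g) := by
    rw [← Real.exp_log ht, ← hg, ← Real.exp_nat_mul]; norm_num
  rw [hexp, ← Real.exp_neg, expProcess, ← Real.exp_add, Real.one_le_exp_iff]
  have h3 := mul_le_mul_of_nonneg_left h2 (Real.sqrt_nonneg (2 * g / N))
  have h4 : (e * (4 * Real.sqrt (2 * g / N))) ^ 2 / 8 * N = 4 * g := by
    rw [mul_pow, he, mul_pow]; linarith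
  rw [h4]
  linarith

-- The Chernoff parameter depends on the random pull count, hence a union bound over its values `1,
-- …, t`.
open scoped Classical in
lemma historyExp_deviates_le {k : ℕ} {μ : Fin k → ℝ} (hμ : ∀ i, μ i ∈ Set.Icc (0 : ℝ) 1)
    (A : Algorithm k) (i : Fin k) {e : ℝ} (he : e ^ 2 = 1) (t : ℕ) :
    historyExp μ A t (fun h => if Deviates (μ i) e i h then 1 else 0) ≤
      t * (((t : ℝ) + 1) ^ 4)⁻¹ := by
  have hpos : 0 ≤ (((t : ℝ) + 1) ^ 4)⁻¹ := by positivity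
  calc _ ≤ historyExp μ A t (fun h => ∑ n ∈ Icc 1 t,
        expProcess (μ i) (e * (4 * Real.sqrt (2 * Real.log ((t : ℝ) + 1) / (n : ℕ)))) i h *
          (((t : ℝ) + 1) ^ 4)⁻¹) := by
        refine historyExp_mono hμ A fun h => ?_
        have hnn : ∀ n ∈ Icc 1 t, 0 ≤ expProcess (μ i)
            (e * (4 * Real.sqrt (2 * Real.log ((t : ℝ) + 1) / (n : ℕ)))) i h *
              (((t : ℝ) + 1) ^ 4)⁻¹ := fun n _ => mul_nonneg (Real.exp_nonneg _) hpos
        split_ifs with hd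
        · exact (one_le_expProcess_of_deviates he hd).trans
            (single_le_sum hnn (mem_Icc.2 ⟨hd.1, pulls_le h i⟩))
        · exact sum_nonneg hnn
    _ = ∑ n ∈ Icc 1 t, historyExp μ A t (expProcess (μ i)
          (e * (4 * Real.sqrt (2 * Real.log ((t : ℝ) + 1) / (n : ℕ)))) i) *
            (((t : ℝ) + 1) ^ 4)⁻¹ := historyExp_sum_mul ..
    _ ≤ ∑ n ∈ Icc 1 t, 1 * (((t : ℝ) + 1) ^ 4)⁻¹ := sum_le_sum fun n _ =>
        mul_le_mul_of_nonneg_right (historyExp_expProcess_le hμ A _ i t) hpos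
    _ = _ := by simp

/-! ### Pulls of a suboptimal arm -/

/-- An arm that was pulled often enough is pulled again only after a deviation. -/
lemma deviates_of_isFairLearnChoice {k : ℕ} [NeZero k] {μ r : Fin k → ℝ} {α : ℝ} {i : Fin k}
    (hi : μ i < μ 0) (hr : 0 ≤ r i) {T t M : ℕ} (ht : t < T) (hM : 1 ≤ M)
    (hMr : r i * T - α ≤ M) (hML : 8 * Real.log T / gap μ i ^ 2 ≤ M) {h : History k t}
    (hN : M ≤ pulls h i)
    (hc : IsFairLearnChoice r α (fun h a => IsUCB1Choice h a) h i) :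
    Deviates (μ 0) (-1) 0 h ∨ Deviates (μ i) 1 i h := by
  have hNM : (M : ℝ) ≤ pulls h i := by exact_mod_cast hN
  have htT : (t : ℝ) + 1 ≤ T := by exact_mod_cast ht
  have hΔ : 0 < gap μ i := sub_pos.2 hi
  unfold IsFairLearnChoice at hc
  split_ifs at hc with hf
  · obtain ⟨j, hj⟩ := hf
    have h1 := hc j
    have h2 : r i * t ≤ r i * T := mul_le_mul_of_nonneg_left (by linarith) hr
    linarith
  · unfold IsUCB1Choice at hc
    split_ifs at hc with h0
    · omega
    push Not at h0
    by_contra! hcon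
    obtain ⟨hn0, hni⟩ := hcon
    have p0 : 1 ≤ pulls h 0 := Nat.one_le_iff_ne_zero.2 (h0 0)
    have pi : 1 ≤ pulls h i := hM.trans hN
    simp only [Deviates, p0, pi, true_and, not_le] at hn0 hni
    have h1 := hc 0
    have q0 : (0 : ℝ) < pulls h 0 := by exact_mod_cast p0
    have qi : (0 : ℝ) < pulls h i := by exact_mod_cast pi
    unfold ucbIndex at h1
    set g := Real.log ((t : ℝ) + 1)
    have hg0 : 0 ≤ g := Real.log_nonneg (by linarith [t.cast_nonneg (α := ℝ)])
    have hwidth : ∀ N : ℝ, 0 < N → Real.sqrt (2 * g * N) = N * Real.sqrt (2 * g / N) := by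
      intro N hN
      rw [show 2 * g * N = N ^ 2 * (2 * g / N) by field_simp, Real.sqrt_mul (by positivity),
        Real.sqrt_sq hN.le]
    rw [hwidth _ q0] at hn0
    rw [hwidth _ qi] at hni
    set c0 := Real.sqrt (2 * g / pulls h 0)
    have k0 : μ 0 - c0 < totalReward h 0 / pulls h 0 := by
      rw [lt_div_iff₀ q0]; linarith
    have ki : (totalReward h i : ℝ) / pulls h i < μ i + Real.sqrt (2 * g / pulls h i) := by
      rw [div_lt_iff₀ qi]; linarith
    -- Without deviations, `μ 0` lies below the index of arm `0`, hence below that of `i`, which is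
    -- less than `μ i` plus two widths.
    have hlt : gap μ i < 2 * Real.sqrt (2 * g / pulls h i) := by unfold gap; linarith
    have hsq : gap μ i ^ 2 < 8 * g / pulls h i := by
      have := pow_lt_pow_left₀ hlt hΔ.le two_ne_zero
      rw [mul_pow, Real.sq_sqrt (by positivity)] at this
      calc _ < _ := this
        _ = _ := by ring
    rw [lt_div_iff₀ qi, mul_comm, ← lt_div_iff₀ (by positivity)] at hsq
    have hlog : g ≤ Real.log T := Real.log_le_log (by positivity) htT
    have : 8 * g / gap μ i ^ 2 ≤ 8 * Real.log T / gap μ i ^ 2 := by gcongr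
    linarith

-- Truncating the count below at `M` makes the first `M` pulls free: the maximum grows only after a
-- deviation, and by at most one.
open scoped Classical in
lemma historyExp_max_pulls_le {k : ℕ} [NeZero k] {μ r : Fin k → ℝ} {α : ℝ}
    (hμ : ∀ i, μ i ∈ Set.Icc (0 : ℝ) 1) {A : Algorithm k} (hA : IsFairUCB r α A) {i : Fin k}
    (hi : μ i < μ 0) (hr : 0 ≤ r i) {T M : ℕ} (hM : 1 ≤ M)
    (hMr : r i * T - α ≤ M) (hML : 8 * Real.log T / gap μ i ^ 2 ≤ M) (t : ℕ) (ht : t ≤ T) :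
    historyExp μ A t (fun h => max (pulls h i : ℝ) M) ≤ M + 2 - 2 / ((t : ℝ) + 1) := by
  induction t with
  | zero => simp [historyExp, historyProb, pulls]
  | succ t ih =>
    have hstep : ∀ h : History k t,
        stepExp μ A (fun h' => max (pulls h' i : ℝ) M) h ≤ max (pulls h i : ℝ) M +
          ((if Deviates (μ 0) (-1) 0 h then 1 else 0) +
            (if Deviates (μ i) 1 i h then 1 else 0)) := by
      intro h
      refine stepExp_le A fun a ha => ?_
      simp only [pulls_snoc, ← sum_mul, sum_bernoulliMass, one_mul]
      have e0 : (0 : ℝ) ≤ if Deviates (μ 0) (-1) 0 h then 1 else 0 := by split_ifs <;> simp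
      have ei : (0 : ℝ) ≤ if Deviates (μ i) 1 i h then 1 else 0 := by split_ifs <;> simp
      by_cases hai : a = i
      · subst hai
        rcases lt_or_ge (pulls h a) M with hlt | hge
        · have : ((pulls h a + 1 : ℕ) : ℝ) ≤ M := by exact_mod_cast hlt
          simp only [if_true]
          rw [max_eq_right this]
          linarith [le_max_right (pulls h a : ℝ) M]
        · have hge' : (M : ℝ) ≤ pulls h a := by exact_mod_cast hge
          have hmax : max ((pulls h a + 1 : ℕ) : ℝ) M ≤ max (pulls h a : ℝ) M + 1 := by
            push_cast
            rw [max_eq_left hge', max_eq_left (by linarith)]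
          simp only [if_true]
          rcases deviates_of_isFairLearnChoice hi hr ht hM hMr hML hge (hA t h a ha) with hd | hd
          · rw [if_pos hd]; linarith
          · rw [if_pos hd]; linarith
      · simp only [hai, if_false, add_zero]
        linarith
    rw [historyExp_succ]
    refine (historyExp_mono hμ A hstep).trans ?_
    rw [historyExp_add, historyExp_add]
    have h0 := historyExp_deviates_le hμ A 0 (e := -1) (by norm_num) t
    have h1 := historyExp_deviates_le hμ A i (e := 1) (by norm_num) t
    have h2 := ih (by omega)
    -- Telescoping bound, equivalent to `t (t + 2) ≤ (t + 1) ^ 3`.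
    have h3 : (t : ℝ) * (((t : ℝ) + 1) ^ 4)⁻¹ ≤ 1 / ((t : ℝ) + 1) - 1 / ((t : ℝ) + 1 + 1) := by
      have : (0 : ℝ) ≤ t := t.cast_nonneg
      rw [div_sub_div _ _ (by positivity) (by positivity), ← div_eq_mul_inv,
        div_le_div_iff₀ (by positivity) (by positivity)]
      have h5 : 0 ≤ ((t : ℝ) + 1) * (1 + t + 2 * t ^ 2 + t ^ 3) := by positivity
      nlinarith
    push_cast
    have e1 : (2 : ℝ) / ((t : ℝ) + 1) = 2 * (1 / ((t : ℝ) + 1)) := by ring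
    have e2 : (2 : ℝ) / ((t : ℝ) + 1 + 1) = 2 * (1 / ((t : ℝ) + 1 + 1)) := by ring
    linarith

lemma expectedPulls_le {k : ℕ} [NeZero k] {μ r : Fin k → ℝ} {α : ℝ}
    (hμ : ∀ i, μ i ∈ Set.Icc (0 : ℝ) 1) {A : Algorithm k} (hA : IsFairUCB r α A) {i : Fin k}
    (hi : μ i < μ 0) (hr : 0 ≤ r i) (T : ℕ) :
    expectedPulls μ A T i ≤ max (r i * T - α) (8 * Real.log T / gap μ i ^ 2) + 3 := by
  set m := max (r i * T - α) (8 * Real.log T / gap μ i ^ 2)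
  have hm : 0 ≤ m := le_max_of_le_right
    (div_nonneg (mul_nonneg (by norm_num) (Real.log_natCast_nonneg T)) (sq_nonneg _))
  -- The `1` excludes UCB1's initial pull of `i` once the threshold is reached.
  have hMm : m ≤ (max 1 ⌈m⌉₊ : ℕ) :=
    (Nat.le_ceil m).trans (Nat.cast_le.2 (le_max_right _ _))
  have hM : ((max 1 ⌈m⌉₊ : ℕ) : ℝ) ≤ m + 1 := by
    rw [Nat.cast_max]
    exact max_le (by simpa using hm) (Nat.ceil_lt_add_one hm).le
  have h1 := historyExp_max_pulls_le hμ hA hi hr (le_max_left _ _)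
    ((le_max_left _ _).trans hMm) ((le_max_right _ _).trans hMm) T le_rfl
  have h2 : expectedPulls μ A T i ≤
      historyExp μ A T (fun h => max (pulls h i : ℝ) (max 1 ⌈m⌉₊ : ℕ)) :=
    historyExp_mono hμ A fun h => le_max_left _ _
  have h3 : (0 : ℝ) ≤ 2 / ((T : ℝ) + 1) := by positivity
  linarith

/-! ### From pulls to regret -/

lemma rRegret_le {k : ℕ} [NeZero k] {μ r : Fin k → ℝ} {α : ℝ}
    (hμ : ∀ i, μ i ∈ Set.Icc (0 : ℝ) 1) (hopt : ∀ i, i ≠ 0 → μ i < μ 0)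
    (hr : ∀ i, 0 ≤ r i) {A : Algorithm k} (hA : IsFairUCB r α A) (T : ℕ) :
    rRegret μ r α A T ≤ (1 + Real.pi ^ 2 / 3) * ∑ i, gap μ i +
      ∑ i ∈ subOptS μ r α T,
        gap μ i * (8 * Real.log (T : ℝ) / gap μ i ^ 2 - (r i * (T : ℝ) - α)) := by
  classical
  unfold rRegret subOptS
  rw [sum_filter, mul_sum, ← sum_add_distrib]
  refine sum_le_sum fun i _ => ?_
  by_cases hi : i = 0
  · simp [hi, gap]
  have hΔ : 0 < gap μ i := sub_pos.2 (hopt i hi)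
  have hE := expectedPulls_le hμ hA (hopt i hi) (hr i) T
  have hpi : (9 : ℝ) ≤ Real.pi ^ 2 := by nlinarith [Real.pi_gt_three]
  have hfl := Int.lt_floor_add_one (r i * (T : ℝ))
  have hmax := le_max_right 0 ((⌊r i * (T : ℝ)⌋ : ℝ) - α)
  split_ifs with hS
  · rw [max_eq_right hS.2.le] at hE
    rw [mul_comm _ (gap μ i), ← mul_add]
    exact mul_le_mul_of_nonneg_left (by linarith) hΔ.le
  -- Outside `S(T)` the fairness quota dominates the pull bound and cancels against the subtracted
  -- quota.
  · have hS' : 8 * Real.log (T : ℝ) / gap μ i ^ 2 ≤ r i * T - α := by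
      by_contra! hlt
      exact hS ⟨hi, hlt⟩
    rw [max_eq_left hS'] at hE
    rw [add_zero, mul_comm _ (gap μ i)]
    exact mul_le_mul_of_nonneg_left (by linarith) hΔ.le

lemma eventually_subOptS_eq_empty {k : ℕ} [NeZero k] {μ r : Fin k → ℝ} (α : ℝ)
    (hr : ∀ i, i ≠ 0 → 0 < r i) : ∀ᶠ T : ℕ in Filter.atTop, subOptS μ r α T = ∅ := by
  have key : ∀ i : Fin k, i ≠ 0 → ∀ᶠ T : ℕ in Filter.atTop,
      8 * Real.log (T : ℝ) / gap μ i ^ 2 ≤ r i * T - α := by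
    intro i hi
    have hri := hr i hi
    have h1 : (fun x : ℝ => 8 / gap μ i ^ 2 * Real.log x + α) =o[Filter.atTop] (fun x => x) :=
      (Real.isLittleO_log_id_atTop.const_mul_left _).add
        (Asymptotics.isLittleO_const_id_atTop α)
    filter_upwards [tendsto_natCast_atTop_atTop.eventually (h1.bound hri)] with T hT
    rw [Real.norm_eq_abs, Real.norm_eq_abs, Nat.abs_cast] at hT
    have := (le_abs_self _).trans hT
    rw [mul_div_right_comm]
    linarith
  filter_upwards [Filter.eventually_all.2 fun i : Fin k =>
    Filter.eventually_imp_distrib_left.2 (key i)] with T hT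
  unfold subOptS
  rw [filter_eq_empty_iff]
  rintro i - ⟨hi, hlt⟩
  exact absurd (hT i hi) (not_le.2 hlt)

end FairMAB

theorem theorem2 (k : ℕ) [NeZero k] (μ r : Fin k → ℝ) (α : ℝ)
    (hμ : ∀ i, μ i ∈ Set.Icc (0 : ℝ) 1) (hopt : ∀ i, i ≠ 0 → μ i < μ 0)
    (hr : ∀ i, r i ∈ Set.Ico (0 : ℝ) (1 / (k : ℝ))) (hα : 0 ≤ α) :
    (∀ A : FairMAB.Algorithm k, FairMAB.IsFairUCB r α A → ∀ T : ℕ, 1 ≤ T →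
      FairMAB.rRegret μ r α A T ≤
        (1 + Real.pi ^ 2 / 3) * ∑ i, FairMAB.gap μ i +
          ∑ i ∈ FairMAB.subOptS μ r α T,
            FairMAB.gap μ i * (8 * Real.log (T : ℝ) / FairMAB.gap μ i ^ 2 - (r i * (T : ℝ) - α))) ∧
    ((∀ i, i ≠ 0 → 0 < r i) →
      ∃ T₀ : ℕ, ∀ A : FairMAB.Algorithm k, FairMAB.IsFairUCB r α A → ∀ T : ℕ, T₀ ≤ T →
        FairMAB.rRegret μ r α A T ≤ (1 + Real.pi ^ 2 / 3) * ∑ i, FairMAB.gap μ i) := by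
  have hr0 : ∀ i, 0 ≤ r i := fun i => (hr i).1
  refine ⟨fun A hA T _ => FairMAB.rRegret_le hμ hopt hr0 hA T, fun hpos => ?_⟩
  obtain ⟨T₀, hT₀⟩ := Filter.eventually_atTop.1
    (FairMAB.eventually_subOptS_eq_empty (μ := μ) α hpos)
  refine ⟨T₀, fun A hA T hT => ?_⟩
  have h := FairMAB.rRegret_le hμ hopt hr0 hA T
  rwa [hT₀ T hT, Finset.sum_empty, add_zero] at h
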